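/- Let $\mathsf A$ be an abelian category. Call $\chi\colon\operatorname{Ob}\mathsf A\to\mathbb N$ additive if $\chi(X)=\chi(X')+\chi(X'')$ for every short exact sequence $0\to X'\to X\to X''\to 0$; call an additive function irreducible if it is non-zero and is not a sum of two non-zero additive functions. If $(\chi_i)_{i\in I}$ is a family of additive functions such that $\{i\in I\mid\chi_i(X)\neq 0\}$ is finite for each object $X$, then $\sum_{i\in I}\chi_i$ is called a locally finite sum. Let $\chi\colon\operatorname{Ob}\mathsf A\to\mathbb N$ be an additive function. Then $\chi$ is a locally finite sum $\chi=\sum_{i\in I}\chi_i$ of irreducible additive functions, and this is unique: if also $\chi=\sum_{j\in J}\chi'_j$ is a locally finite sum of irreducible additive functions, there is a bijection $e\colon I\to J$ with $\chi_i=\chi'_{e(i)}$ for all $i\in I$. Explicitly, let $\mathsf S_\chi$ be the Serre subcategory of all objects $X$ with $\chi(X)=0$. Every object of the quotient category $\mathsf A/\mathsf S_\chi$ has finite length. Let $R$ be a representative set of the simple objects of $\mathsf A/\mathsf S_\chi$ (one from each isomorphism class). For $S\in R$ let $\mathsf S_S$ be the Serre subcategory of $\mathsf A$ formed by all objects $X$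 such that a composition series of $X$ in $\mathsf A/\mathsf S_\chi$ has no factor isomorphic to $S$, and let $\chi_S(X)$ be the length of $X$ in $\mathsf A/\mathsf S_S$. Then each $\chi_S$ takes finite values and is an irreducible additive function, for each object $X$ only finitely many $S\in R$ satisfy $\chi_S(X)\neq 0$, and \[\chi=\sum_{S\in R}\chi(S)\,\chi_S .\] -/

import Mathlib

open CategoryTheory CategoryTheory.Limits
open scoped ZeroObject

universe w' w v u

/-! ### Additive functions -/

/-- An additive function on an abelian category `A`: a function `χ : Ob A → ℕ` such that
`χ X = χ X' + χ X''` for each short exact sequence `0 ⟶ X' ⟶ X ⟶ X'' ⟶ 0`. -/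
@[ext]
structure AdditiveFunction (A : Type u) [Category.{v} A] [Abelian A] where
  /-- the underlying function on objects -/
  toFun : A → ℕ
  map_shortExact : ∀ E : ShortComplex A, E.ShortExact → toFun E.X₂ = toFun E.X₁ + toFun E.X₃

namespace AdditiveFunction

variable {A : Type u} [Category.{v} A] [Abelian A]

instance : CoeFun (AdditiveFunction A) (fun _ => A → ℕ) := ⟨AdditiveFunction.toFun⟩

instance : Zero (AdditiveFunction A) := ⟨⟨fun _ => 0, fun _ _ => rfl⟩⟩

instance : Add (AdditiveFunction A) :=
  ⟨fun χ ψ => ⟨fun X => χ X + ψ X, fun E hE => by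
    rw [χ.map_shortExact E hE, ψ.map_shortExact E hE]; omega⟩⟩

/-- An additive function is irreducible if it is non-zero and is not the sum of two non-zero
additive functions. -/
def IsIrreducible (χ : AdditiveFunction A) : Prop :=
  χ ≠ 0 ∧ ∀ χ₁ χ₂ : AdditiveFunction A, χ = χ₁ + χ₂ → χ₁ = 0 ∨ χ₂ = 0

/-- `χ` is the locally finite sum of the family `ψ`: for each object `X` only finitely many
`ψ i X` are non-zero, and `χ X` is their sum. -/
def IsLocallyFiniteSum {I : Type w} (ψ : I → AdditiveFunction A) (χ : AdditiveFunction A) : Prop :=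
  ∀ X : A, {i : I | ψ i X ≠ 0}.Finite ∧ χ X = ∑ᶠ i, ψ i X

/-- The class `S_χ` of all objects `X` with `χ X = 0`. -/
def kernelClass (χ : AdditiveFunction A) : ObjectProperty A := fun X => χ X = 0

lemma map_isZero (χ : AdditiveFunction A) {X : A} (hX : IsZero X) : χ X = 0 := by
  have h := χ.map_shortExact (ShortComplex.mk (0 : X ⟶ X) (0 : X ⟶ X) (by simp))
    { exact := ShortComplex.exact_of_isZero_X₂ _ hX
      mono_f := ⟨fun _ _ _ => hX.eq_of_tgt _ _⟩
      epi_g := ⟨fun _ _ _ => hX.eq_of_src _ _⟩ }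
  dsimp at h
  omega

instance (χ : AdditiveFunction A) : χ.kernelClass.IsSerreClass where
  exists_zero := ⟨0, isZero_zero A, χ.map_isZero (isZero_zero A)⟩
  prop_of_mono {X Y} f _ hY := by
    have h := χ.map_shortExact (ShortComplex.mk f (cokernel.π f) (by simp))
      { exact := ShortComplex.exact_cokernel f
        mono_f := inferInstance
        epi_g := inferInstance }
    dsimp [kernelClass] at h hY ⊢
    omega
  prop_of_epi {X Y} f _ hX := by
    have h := χ.map_shortExact (ShortComplex.mk (kernel.ι f) f (by simp))
      { exact := ShortComplex.exact_kernel f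
        mono_f := inferInstance
        epi_g := inferInstance }
    dsimp [kernelClass] at h hX ⊢
    omega
  prop_X₂_of_shortExact {E} hE h₁ h₃ := by
    have h := χ.map_shortExact E hE
    dsimp [kernelClass] at h₁ h₃ ⊢
    omega

end AdditiveFunction

/-! ### Composition series and length -/

section CompositionSeries

variable {D : Type u} [Category.{v} D]

/-- `HasCompositionFactors X [T₁, …, Tₙ]` says that `X` has a composition series with these
factors, listed from the top: there are monomorphisms `0 = Xₙ ⟶ … ⟶ X₁ ⟶ X₀ = X` such that the
cokernel of `Xᵢ ⟶ Xᵢ₋₁` is the simple object `Tᵢ`. -/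
inductive HasCompositionFactors [HasZeroMorphisms D] : D → List D → Prop
  | nil {X : D} (hX : IsZero X) : HasCompositionFactors X []
  | cons {X' X T : D} {l : List D} (i : X' ⟶ X) (p : X ⟶ T) (w : i ≫ p = 0)
      (hE : (ShortComplex.mk i p w).ShortExact) (hT : Simple T)
      (h : HasCompositionFactors X' l) : HasCompositionFactors X (T :: l)

/-- The length of an object of an abelian category: the number of factors of a composition series
(by the Jordan-Hölder theorem, any two have the same number), and `⊤` if there is none. -/
noncomputable def objectLength [HasZeroMorphisms D] (X : D) : ℕ∞ :=
  ⨅ (l : List D) (_ : HasCompositionFactors X l), (l.length : ℕ∞)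

/-- The class of objects that have a composition series in which no factor is isomorphic
to `S`. -/
def noFactorClass [HasZeroMorphisms D] (S : D) : ObjectProperty D := fun X =>
  ∃ l : List D, HasCompositionFactors X l ∧ ∀ T ∈ l, ¬ Nonempty (T ≅ S)

/-- `R` is a representative set of the simple objects: its members are simple and each simple
object is isomorphic to exactly one of them. -/
def IsRepresentativeSetOfSimples [HasZeroMorphisms D] (R : Set D) : Prop :=
  (∀ S ∈ R, Simple S) ∧ ∀ T : D, Simple T → ∃! S, S ∈ R ∧ Nonempty (T ≅ S)

variable [Abelian D]

lemma noFactorClass_cons {S X' X T : D} (i : X' ⟶ X) (p : X ⟶ T) (w : i ≫ p = 0)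
    (hE : (ShortComplex.mk i p w).ShortExact) (hT : Simple T) (hTS : ¬ Nonempty (T ≅ S))
    (h : noFactorClass S X') : noFactorClass S X := by
  obtain ⟨l, hl, hlS⟩ := h
  refine ⟨T :: l, .cons i p w hE hT hl, ?_⟩
  intro T' hT'
  rcases List.mem_cons.1 hT' with rfl | h
  exacts [hTS, hlS _ h]

lemma noFactorClass_of_mono {S Y : D} {l : List D} (hY : HasCompositionFactors Y l)
    (hl : ∀ T ∈ l, ¬ Nonempty (T ≅ S)) {X : D} (f : X ⟶ Y) [Mono f] : noFactorClass S X := by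
  induction hY generalizing X with
  | nil h => exact ⟨[], .nil (h.of_mono f), by simp⟩
  | @cons Y' Y T l i p w hE hT h ih =>
    have hmono : Mono i := hE.mono_f
    have ih' := fun {Z : D} (g : Z ⟶ Y') (_ : Mono g) =>
      ih (fun T hT => hl T (List.mem_cons_of_mem _ hT)) g
    by_cases hz : f ≫ p = 0
    · have hg : hE.exact.lift f hz ≫ i = f := hE.exact.lift_f f hz
      exact ih' (hE.exact.lift f hz) (mono_of_mono_fac hg)
    · have hepi : Epi (f ≫ p) := epi_of_nonzero_to_simple hz
      have hz' : (kernel.ι (f ≫ p) ≫ f) ≫ p = 0 := by simp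
      have hg : hE.exact.lift _ hz' ≫ i = kernel.ι (f ≫ p) ≫ f := hE.exact.lift_f _ hz'
      exact noFactorClass_cons (kernel.ι (f ≫ p)) (f ≫ p) (by simp)
        { exact := ShortComplex.exact_kernel _
          mono_f := inferInstance
          epi_g := hepi } hT (hl T (by simp))
        (ih' (hE.exact.lift _ hz') (mono_of_mono_fac hg))

lemma noFactorClass_of_epi {S Y : D} {l : List D} (hY : HasCompositionFactors Y l)
    (hl : ∀ T ∈ l, ¬ Nonempty (T ≅ S)) {X : D} (f : Y ⟶ X) [Epi f] : noFactorClass S X := by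
  induction hY generalizing X with
  | nil h => exact ⟨[], .nil (h.of_epi f), by simp⟩
  | @cons Y' Y T l i p w hE hT h ih =>
    have hp : Epi p := hE.epi_g
    have ih' := fun {Z : D} (g : Y' ⟶ Z) (_ : Epi g) =>
      ih (fun T hT => hl T (List.mem_cons_of_mem _ hT)) g
    have hz : i ≫ f ≫ cokernel.π (i ≫ f) = 0 := by
      rw [← Category.assoc]; exact cokernel.condition _
    have hg : p ≫ hE.exact.desc _ hz = f ≫ cokernel.π (i ≫ f) := hE.exact.g_desc _ hz
    set g := hE.exact.desc _ hz
    have hgepi : Epi g := by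
      have : Epi (p ≫ g) := by rw [hg]; infer_instance
      exact epi_of_epi p g
    by_cases h0 : g = 0
    · have : cokernel.π (i ≫ f) = 0 := by
        rw [← cancel_epi f, ← hg, h0]; simp
      exact ih' (i ≫ f) (Preadditive.epi_of_cokernel_zero this)
    · have : IsIso g := isIso_of_epi_of_nonzero h0
      have hsimple : Simple (cokernel (i ≫ f)) := Simple.of_iso (asIso g).symm
      refine noFactorClass_cons (Abelian.image.ι (i ≫ f)) (cokernel.π (i ≫ f))
        (by simp)
        { exact := ShortComplex.exact_kernel _
          mono_f := inferInstance
          epi_g := inferInstance } hsimple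
        (fun ⟨e⟩ => hl T (by simp) ⟨asIso g ≪≫ e⟩)
        (ih' (Abelian.factorThruImage (i ≫ f)) inferInstance)

lemma noFactorClass_of_extension {S B : D} {l : List D} (hB : HasCompositionFactors B l)
    (hl : ∀ T ∈ l, ¬ Nonempty (T ≅ S)) {A X : D} (a : A ⟶ X) (q : X ⟶ B) (w : a ≫ q = 0)
    (hE : (ShortComplex.mk a q w).ShortExact) (hA : noFactorClass S A) : noFactorClass S X := by
  induction hB generalizing A X with
  | nil h =>
    have : Mono a := hE.mono_f
    have : Epi a := hE.exact.epi_f (h.eq_of_tgt _ _)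
    obtain ⟨l, hl, hl'⟩ := hA
    exact noFactorClass_of_epi hl hl' a
  | @cons B' B T l i p w' hE' hT h ih =>
    have : Mono a := hE.mono_f
    have : Epi q := hE.epi_g
    have : Mono i := hE'.mono_f
    have : Epi p := hE'.epi_g
    have hcond : pullback.fst q i ≫ q = pullback.snd q i ≫ i := pullback.condition
    refine noFactorClass_cons (pullback.fst q i) (q ≫ p)
      (by rw [reassoc_of% hcond, w', comp_zero]) ?_ hT (hl T (by simp)) ?_
    · refine { exact := ?_, mono_f := by dsimp; infer_instance, epi_g := by dsimp; infer_instance }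
      refine ShortComplex.exact_of_f_is_kernel _ (KernelFork.IsLimit.ofι' _ _ ?_)
      intro Z k hk
      have hk' : (k ≫ q) ≫ p = 0 := by simpa using hk
      exact ⟨pullback.lift k (hE'.exact.lift _ hk') (hE'.exact.lift_f _ hk').symm, pullback.lift_fst _ _ _⟩
    · have hw : pullback.lift a (0 : A ⟶ B') (by rw [w, zero_comp]) ≫ pullback.snd q i = 0 :=
        pullback.lift_snd _ _ _
      refine ih (fun T hT => hl T (List.mem_cons_of_mem _ hT)) _ _ hw ?_ hA
      have hm : Mono (pullback.lift a (0 : A ⟶ B') (by rw [w, zero_comp]) : A ⟶ pullback q i) :=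
        mono_of_mono_fac (pullback.lift_fst _ _ _)
      refine { exact := ?_, mono_f := hm, epi_g := by dsimp; infer_instance }
      refine ShortComplex.exact_of_f_is_kernel _ (KernelFork.IsLimit.ofι' _ _ ?_)
      intro Z k hk
      have hk' : (k ≫ pullback.fst q i) ≫ q = 0 := by
        rw [Category.assoc, hcond, reassoc_of% hk, zero_comp]
      refine ⟨hE.exact.lift _ hk', ?_⟩
      apply pullback.hom_ext
      · exact (Category.assoc _ _ _).trans
          ((congrArg _ (pullback.lift_fst _ _ _)).trans (hE.exact.lift_f _ hk'))
      · exact (Category.assoc _ _ _).trans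
          (((congrArg _ (pullback.lift_snd _ _ _)).trans comp_zero).trans hk.symm)

instance noFactorClass_isSerreClass (S : D) : (noFactorClass S).IsSerreClass where
  exists_zero := ⟨0, isZero_zero D, [], .nil (isZero_zero D), by simp⟩
  prop_of_mono f _ := fun ⟨_, h, hl⟩ => noFactorClass_of_mono h hl f
  prop_of_epi f _ := fun ⟨_, h, hl⟩ => noFactorClass_of_epi h hl f
  prop_X₂_of_shortExact hE h₁ := fun ⟨_, h, hl⟩ =>
    noFactorClass_of_extension h hl _ _ _ hE h₁

end CompositionSeries

/-! ### Serre quotients -/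

section SerreQuotient

variable {A : Type u} [Category.{v} A] [Abelian A] (P : ObjectProperty A) [P.IsSerreClass]

/-- The quotient category `A/P` of `A` by the Serre class `P`: the localization of `A` at the
morphisms whose kernel and cokernel lie in `P`. -/
abbrev SerreQuotient : Type u := P.isoModSerre.Localization

noncomputable instance : Abelian (SerreQuotient P) :=
  ObjectProperty.SerreClassLocalization.abelian P.isoModSerre.Q P

/-- The quotient functor `A ⥤ A/P`. -/
abbrev SerreQuotient.functor : A ⥤ SerreQuotient P := P.isoModSerre.Q

/-- The objects of `A/P` are the objects of `A`. -/
abbrev SerreQuotient.underlying (X : SerreQuotient P) : A :=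
  (Localization.Construction.objEquiv P.isoModSerre).symm X

/-- For an object `S` of `A/P`, the class of all objects `X` of `A` such that a composition series
of `X` in `A/P` has no factor isomorphic to `S`. -/
def avoidingClass (S : SerreQuotient P) : ObjectProperty A :=
  (noFactorClass S).inverseImage (SerreQuotient.functor P)

instance (S : SerreQuotient P) : (avoidingClass P S).IsSerreClass := by
  have := ObjectProperty.SerreClassLocalization.preservesFiniteLimits P.isoModSerre.Q P
  have := ObjectProperty.SerreClassLocalization.preservesFiniteColimits P.isoModSerre.Q P
  exact inferInstanceAs ((noFactorClass S).inverseImage (SerreQuotient.functor P)).IsSerreClass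

end SerreQuotient

/-! The function `χ` descends to `A/S_χ`, where it vanishes only on zero objects. Such a faithful
function drops strictly along proper subobjects, so every object has a composition series
(`IsFaithful.exists_hasCompositionFactors`). Jordan-Hölder (`IsFaithful.sum_map_eq`) then makes
additive functions on the quotient the same as isomorphism-invariant ℕ-valued weights on its simple
objects. Hence the irreducible ones are the multiplicities of single simple objects, and any `α` is
the sum of these with coefficients `α S`; reading off the value at `S` gives uniqueness.

To return to `A`: over ℕ every summand of `χ` vanishes wherever `χ` does, so decompositions of `χ`
and of its descent correspond (`descend_isIrreducible_iff`). It remains to see that the multiplicity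
of `S` is the length in `A/S_S`. The class `S_S` is the kernel of this multiplicity, which is
therefore faithful on `A/S_S`, and `factorMultiplicity_eq_one_of_simple` shows that it is 1 on each
simple object there. -/

section

variable {D : Type u} [Category.{v} D] [Abelian D]

/-! ### Short exact sequences and composition series -/

lemma shortExact_kernel_of_epi {X Y : D} (f : X ⟶ Y) [Epi f] :
    (ShortComplex.mk (kernel.ι f) f (kernel.condition f)).ShortExact where
  exact := ShortComplex.exact_kernel f

lemma shortExact_cokernel_of_mono {X Y : D} (f : X ⟶ Y) [Mono f] :
    (ShortComplex.mk f (cokernel.π f) (cokernel.condition f)).ShortExact where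
  exact := ShortComplex.exact_cokernel f

/-- Base change of a short exact sequence along a morphism `q` that remains surjective onto the
third term. -/
lemma shortExact_of_isPullback {K X₁ X₂ X T : D} {a : K ⟶ X₁} {b : K ⟶ X₂} {q : X₁ ⟶ X}
    {i : X₂ ⟶ X} {p : X ⟶ T} {w : i ≫ p = 0} (hK : IsPullback a b q i)
    (hE : (ShortComplex.mk i p w).ShortExact) (hq : Epi (q ≫ p)) :
    ∃ w' : a ≫ q ≫ p = 0, (ShortComplex.mk a (q ≫ p) w').ShortExact := by
  have : Mono i := hE.mono_f
  refine ⟨by rw [hK.w_assoc, w, comp_zero], ?_⟩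
  have : Mono a := (MorphismProperty.monomorphisms D).of_isPullback hK.flip ‹Mono i›
  refine { exact := ?_, mono_f := this, epi_g := hq }
  refine ShortComplex.exact_of_f_is_kernel _ (KernelFork.IsLimit.ofι' _ _ ?_)
  intro Z k hk
  have hk' : (k ≫ q) ≫ p = 0 := by simpa using hk
  exact ⟨hK.lift k (hE.exact.lift _ hk') (hE.exact.lift_f _ hk').symm, hK.lift_fst _ _ _⟩

lemma shortExact_comp_iso {X' X Y T : D} {i : X' ⟶ X} {p : X ⟶ T} {w : i ≫ p = 0}
    (hE : (ShortComplex.mk i p w).ShortExact) (e : X ≅ Y) :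
    (ShortComplex.mk (i ≫ e.hom) (e.inv ≫ p) (by simpa using w)).ShortExact :=
  ShortComplex.shortExact_of_iso
    (S₁ := ShortComplex.mk i p w) (ShortComplex.isoMk (Iso.refl _) e (Iso.refl _) (by simp) (by simp)) hE

namespace AdditiveFunction

variable (χ : AdditiveFunction D)

lemma map_iso {X Y : D} (e : X ≅ Y) : χ X = χ Y := by
  have h := χ.map_shortExact _ (shortExact_cokernel_of_mono e.hom)
  have h' := χ.map_isZero (isZero_cokernel_of_epi e.hom)
  dsimp at h h'
  omega

lemma map_mono {X Y : D} (f : X ⟶ Y) [Mono f] : χ Y = χ X + χ (cokernel f) :=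
  χ.map_shortExact _ (shortExact_cokernel_of_mono f)

lemma map_epi {X Y : D} (f : X ⟶ Y) [Epi f] : χ X = χ (kernel f) + χ Y :=
  χ.map_shortExact _ (shortExact_kernel_of_epi f)

/-- An additive function that vanishes only on zero objects. -/
def IsFaithful : Prop := ∀ X : D, χ X = 0 → IsZero X

end AdditiveFunction

namespace HasCompositionFactors

lemma of_iso {X Y : D} {l : List D} (h : HasCompositionFactors X l) (e : X ≅ Y) :
    HasCompositionFactors Y l := by
  cases h with
  | nil hX => exact .nil (hX.of_iso e.symm)
  | cons i p w hE hT h => exact .cons _ _ _ (shortExact_comp_iso hE e) hT h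

/-- Induction on the series of `B`: the pullback of its first term `B' ⟶ B` to `X` is an extension
of `B'` by `A`, and its cokernel in `X` is the top factor of `B`. -/
lemma append {B : D} {l : List D} (hB : HasCompositionFactors B l) {A X : D} {l' : List D}
    {a : A ⟶ X} {q : X ⟶ B} {w : a ≫ q = 0} (hE : (ShortComplex.mk a q w).ShortExact)
    (hA : HasCompositionFactors A l') : HasCompositionFactors X (l ++ l') := by
  induction hB generalizing A X with
  | nil h =>
    have : Mono a := hE.mono_f
    have : Epi a := hE.exact.epi_f (h.eq_of_tgt _ _)
    have : IsIso a := isIso_of_mono_of_epi a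
    exact hA.of_iso (asIso a)
  | @cons B' B T l i p w' hE' hT h ih =>
    have : Mono a := hE.mono_f
    have : Epi q := hE.epi_g
    have : Mono i := hE'.mono_f
    have : Epi p := hE'.epi_g
    have hK := IsPullback.of_hasPullback q i
    obtain ⟨w₁, h₁⟩ := shortExact_of_isPullback hK hE' inferInstance
    refine .cons _ _ w₁ h₁ hT (ih (a := hK.lift a 0 (by rw [w, zero_comp]))
      (q := pullback.snd q i) (w := hK.lift_snd _ _ _) ?_ hA)
    have hm : Mono (hK.lift a (0 : A ⟶ B') (by rw [w, zero_comp])) :=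
      mono_of_mono_fac (hK.lift_fst _ _ _)
    refine { exact := ?_, mono_f := hm, epi_g := by dsimp; infer_instance }
    refine ShortComplex.exact_of_f_is_kernel _ (KernelFork.IsLimit.ofι' _ _ ?_)
    intro Z k hk
    have hk' : (k ≫ pullback.fst q i) ≫ q = 0 := by
      rw [Category.assoc, hK.w, reassoc_of% hk, zero_comp]
    refine ⟨hE.exact.lift _ hk', hK.hom_ext ?_ ?_⟩
    · rw [Category.assoc, hK.lift_fst]
      exact hE.exact.lift_f _ hk'
    · rw [Category.assoc, hK.lift_snd, comp_zero, hk]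

lemma of_simple {T : D} (hT : Simple T) : HasCompositionFactors T [T] :=
  .cons (0 : (0 : D) ⟶ T) (𝟙 T) zero_comp
    { exact := ShortComplex.exact_of_f_is_kernel _
        (KernelFork.IsLimit.ofMonoOfIsZero _ inferInstance (isZero_zero D))
      mono_f := ⟨fun _ _ _ => (isZero_zero D).eq_of_tgt _ _⟩
      epi_g := by dsimp; infer_instance } hT (.nil (isZero_zero D))

lemma eq_nil_of_isZero {X : D} {l : List D} (h : HasCompositionFactors X l) (hX : IsZero X) :
    l = [] := by
  cases h with
  | nil => rfl
  | cons i p w hE hT h =>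
    have : Epi p := hE.epi_g
    exact (Simple.not_isZero _ (hX.of_epi p)).elim

lemma simple_of_mem {X : D} {l : List D} (h : HasCompositionFactors X l) :
    ∀ T ∈ l, Simple T := by
  induction h with
  | nil => simp
  | cons i p w hE hT h ih => simpa using ⟨hT, ih⟩

lemma sum_map (χ : AdditiveFunction D) {X : D} {l : List D} (h : HasCompositionFactors X l) :
    (l.map χ).sum = χ X := by
  induction h with
  | nil hX => simp [χ.map_isZero hX]
  | cons i p w hE hT h ih =>
    have := χ.map_shortExact _ hE
    dsimp at this
    rw [List.map_cons, List.sum_cons, ih, this, add_comm]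

end HasCompositionFactors

/-! ### Faithful additive functions: composition series and the Jordan-Hölder theorem -/

namespace AdditiveFunction

variable {χ : AdditiveFunction D}

lemma IsFaithful.lt_of_shortExact_left (hχ : χ.IsFaithful) {X' X T : D} {i : X' ⟶ X} {p : X ⟶ T}
    {w : i ≫ p = 0} (hE : (ShortComplex.mk i p w).ShortExact) (hT : ¬ IsZero T) :
    χ X' < χ X := by
  have h := χ.map_shortExact _ hE
  have h' : χ T ≠ 0 := fun h => hT (hχ _ h)
  dsimp at h
  omega

lemma IsFaithful.isIso_of_mono (hχ : χ.IsFaithful) {X Y : D} (f : X ⟶ Y) [Mono f]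
    (h : χ Y ≤ χ X) : IsIso f := by
  have h' := χ.map_mono f
  have : Epi f := Preadditive.epi_of_isZero_cokernel f (hχ _ (by omega))
  exact isIso_of_mono_of_epi f

lemma IsFaithful.simple (hχ : χ.IsFaithful) {X : D} (hX : χ X ≠ 0)
    (h : ∀ {Y : D} (f : Y ⟶ X) [Mono f], χ Y = 0 ∨ χ Y = χ X) : Simple X where
  mono_isIso_iff_nonzero {Y} f _ := by
    constructor
    · rintro _ rfl
      exact hX (χ.map_isZero (IsZero.of_epi_zero Y X))
    · intro hf
      rcases h f with h | h
      · exact (hf ((hχ _ h).eq_of_src _ _)).elim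
      · exact hχ.isIso_of_mono f h.ge

/-- If `X` is not simple, some subobject `Y` has a value strictly between 0 and `χ X`; then `X/Y` is
non-zero with smaller value, and its simple quotients are quotients of `X`. -/
lemma IsFaithful.exists_simple_quotient (hχ : χ.IsFaithful) (X : D) (hX : ¬ IsZero X) :
    ∃ (T : D) (p : X ⟶ T), Epi p ∧ Simple T := by
  induction hn : χ X using Nat.strong_induction_on generalizing X with
  | _ n ih =>
    subst hn
    by_cases hs : Simple X
    · exact ⟨X, 𝟙 X, inferInstance, hs⟩
    · have : ∃ (Y : D) (f : Y ⟶ X), Mono f ∧ χ Y ≠ 0 ∧ χ Y ≠ χ X := by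
        by_contra! h
        exact hs (hχ.simple (fun h => hX (hχ _ h)) fun {Y} f hf => by
          by_cases h0 : χ Y = 0
          exacts [Or.inl h0, Or.inr (h Y f hf h0)])
      obtain ⟨Y, f, _, h0, h1⟩ := this
      have h := χ.map_mono f
      obtain ⟨T, p, _, hT⟩ := ih (χ (cokernel f)) (by omega) (cokernel f)
        (fun hc => by have := χ.map_isZero hc; omega) rfl
      exact ⟨T, cokernel.π f ≫ p, inferInstance, hT⟩

lemma IsFaithful.exists_hasCompositionFactors (hχ : χ.IsFaithful) (X : D) :
    ∃ l, HasCompositionFactors X l := by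
  induction hn : χ X using Nat.strong_induction_on generalizing X with
  | _ n ih =>
    subst hn
    by_cases hX : IsZero X
    · exact ⟨[], .nil hX⟩
    · obtain ⟨T, p, _, hT⟩ := hχ.exists_simple_quotient X hX
      obtain ⟨l, hl⟩ := ih _ (hχ.lt_of_shortExact_left (shortExact_kernel_of_epi p)
        (Simple.not_isZero T)) _ rfl
      exact ⟨T :: l, .cons _ _ _ (shortExact_kernel_of_epi p) hT hl⟩

/-- The Jordan-Hölder theorem: sums of isomorphism invariant weights over the factors of a
composition series do not depend on the series. -/
theorem IsFaithful.sum_map_eq (hχ : χ.IsFaithful) {c : D → ℕ}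
    (hc : ∀ T T' : D, (T ≅ T') → c T = c T') {X : D} {l₁ l₂ : List D}
    (h₁ : HasCompositionFactors X l₁) (h₂ : HasCompositionFactors X l₂) :
    (l₁.map c).sum = (l₂.map c).sum := by
  induction hn : χ X using Nat.strong_induction_on generalizing X l₁ l₂ with
  | _ n ih =>
    subst hn
    by_cases hX : IsZero X
    · rw [h₁.eq_nil_of_isZero hX, h₂.eq_nil_of_isZero hX]
    cases h₁ with
    | nil h => exact (hX h).elim
    | @cons X₁ _ T₁ l₁ i₁ p₁ w₁ hE₁ hT₁ h₁ =>
    cases h₂ with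
    | nil h => exact (hX h).elim
    | @cons X₂ _ T₂ l₂ i₂ p₂ w₂ hE₂ hT₂ h₂ =>
    have hlt₁ := hχ.lt_of_shortExact_left hE₁ (Simple.not_isZero T₁)
    have hlt₂ := hχ.lt_of_shortExact_left hE₂ (Simple.not_isZero T₂)
    have : Mono i₁ := hE₁.mono_f
    have : Mono i₂ := hE₂.mono_f
    have : Epi p₁ := hE₁.epi_g
    have : Epi p₂ := hE₂.epi_g
    simp only [List.map_cons, List.sum_cons]
    -- If this composite vanishes, `X₁` is contained in `X₂` and `T₁ ≅ T₂`; comparing values of `χ`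
    -- forces `X₁ ≅ X₂`.
    by_cases hz : i₁ ≫ p₂ = 0
    · have hg : p₁ ≫ hE₁.exact.desc _ hz = p₂ := hE₁.exact.g_desc _ hz
      set g := hE₁.exact.desc _ hz
      have : Epi g := epi_of_epi_fac hg
      have hg0 : g ≠ 0 := by
        intro h0
        rw [h0, comp_zero] at hg
        exact Simple.not_isZero T₂ (IsZero.of_epi_eq_zero p₂ hg.symm)
      have : IsIso g := isIso_of_epi_of_nonzero hg0
      have hf : hE₂.exact.lift _ hz ≫ i₂ = i₁ := hE₂.exact.lift_f _ hz
      set f := hE₂.exact.lift _ hz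
      have : Mono f := mono_of_mono_fac hf
      have hle : χ X₂ ≤ χ X₁ := by
        have e₁ := χ.map_shortExact _ hE₁
        have e₂ := χ.map_shortExact _ hE₂
        have e₃ := χ.map_iso (asIso g)
        dsimp at e₁ e₂ e₃
        omega
      have : IsIso f := hχ.isIso_of_mono f hle
      rw [hc _ _ (asIso g), ih _ hlt₁ h₁ (h₂.of_iso (asIso f).symm) rfl]
    -- Otherwise neither subobject contains the other. With `K` their intersection, `X₁/K ≅ T₂` and
    -- `X₂/K ≅ T₁`, so a series of `K` extends to both, and the two resulting series of `X` differ
    -- by swapping `T₁` and `T₂`.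
    · have hz' : i₂ ≫ p₁ ≠ 0 := by
        intro h0
        have hg : p₂ ≫ hE₂.exact.desc _ h0 = p₁ := hE₂.exact.g_desc _ h0
        set g := hE₂.exact.desc _ h0
        have : Epi g := epi_of_epi_fac hg
        have hg0 : g ≠ 0 := by
          intro h0
          rw [h0, comp_zero] at hg
          exact Simple.not_isZero T₁ (IsZero.of_epi_eq_zero p₁ hg.symm)
        have : IsIso g := isIso_of_epi_of_nonzero hg0
        exact hz (by rw [← cancel_mono g, Category.assoc, hg, w₁, zero_comp])
      have hK := IsPullback.of_hasPullback i₁ i₂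
      obtain ⟨lK, hlK⟩ := hχ.exists_hasCompositionFactors (pullback i₁ i₂)
      obtain ⟨v₁, s₁⟩ := shortExact_of_isPullback hK hE₂ (epi_of_nonzero_to_simple hz)
      obtain ⟨v₂, s₂⟩ := shortExact_of_isPullback hK.flip hE₁ (epi_of_nonzero_to_simple hz')
      rw [ih _ hlt₁ h₁ (.cons _ _ v₁ s₁ hT₂ hlK) rfl, ih _ hlt₂ h₂ (.cons _ _ v₂ s₂ hT₁ hlK) rfl]
      simp only [List.map_cons, List.sum_cons]
      omega

/-- The additive function with prescribed values on the simple objects. -/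
noncomputable def IsFaithful.ofWeights (hχ : χ.IsFaithful) (c : D → ℕ)
    (hc : ∀ T T' : D, (T ≅ T') → c T = c T') : AdditiveFunction D where
  toFun X := ((hχ.exists_hasCompositionFactors X).choose.map c).sum
  map_shortExact E hE := by
    have h₁ := (hχ.exists_hasCompositionFactors E.X₁).choose_spec
    have h₃ := (hχ.exists_hasCompositionFactors E.X₃).choose_spec
    rw [hχ.sum_map_eq hc (hχ.exists_hasCompositionFactors E.X₂).choose_spec (h₃.append hE h₁),
      List.map_append, List.sum_append, add_comm]

lemma IsFaithful.ofWeights_apply (hχ : χ.IsFaithful) {c : D → ℕ}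
    (hc : ∀ T T' : D, (T ≅ T') → c T = c T') {X : D} {l : List D}
    (h : HasCompositionFactors X l) : hχ.ofWeights c hc X = (l.map c).sum :=
  hχ.sum_map_eq hc (hχ.exists_hasCompositionFactors X).choose_spec h

lemma IsFaithful.objectLength_ne_top (hχ : χ.IsFaithful) (X : D) : objectLength X ≠ ⊤ := by
  obtain ⟨l, hl⟩ := hχ.exists_hasCompositionFactors X
  exact ne_top_of_le_ne_top (ENat.natCast_ne_top l.length) (iInf₂_le l hl)

/-- When every simple object has value 1, summing `χ` over the factors counts them, so all series of
`X` have `χ X` terms. -/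
lemma IsFaithful.objectLength_eq (hχ : χ.IsFaithful) (h : ∀ T : D, Simple T → χ T = 1) (X : D) :
    objectLength X = χ X := by
  have key : ∀ l, HasCompositionFactors X l → (l.length : ℕ∞) = χ X := fun l hl => by
    rw [← hl.sum_map χ, List.map_congr_left (g := fun _ => 1)
      (fun T hT => h T (hl.simple_of_mem T hT))]
    simp
  obtain ⟨l, hl⟩ := hχ.exists_hasCompositionFactors X
  exact le_antisymm ((iInf₂_le l hl).trans (key l hl).le)
    (le_iInf₂ fun l hl => (key l hl).ge)

end AdditiveFunction

end

/-! ### Descent of additive functions to Serre quotients -/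

section

variable {A : Type u} [Category.{v} A] [Abelian A] (P : ObjectProperty A) [P.IsSerreClass]

instance SerreQuotient.preservesFiniteLimits_functor :
    PreservesFiniteLimits (SerreQuotient.functor P) :=
  ObjectProperty.SerreClassLocalization.preservesFiniteLimits P.isoModSerre.Q P

instance SerreQuotient.preservesFiniteColimits_functor :
    PreservesFiniteColimits (SerreQuotient.functor P) :=
  ObjectProperty.SerreClassLocalization.preservesFiniteColimits P.isoModSerre.Q P

lemma SerreQuotient.isZero_functor_obj_iff (X : A) :
    IsZero ((SerreQuotient.functor P).obj X) ↔ P X :=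
  ObjectProperty.SerreClassLocalization.isZero_obj_iff P.isoModSerre.Q P X

lemma SerreQuotient.isZero_iff (Y : SerreQuotient P) :
    IsZero Y ↔ P (SerreQuotient.underlying P Y) :=
  SerreQuotient.isZero_functor_obj_iff P (SerreQuotient.underlying P Y)

namespace AdditiveFunction

lemma map_eq_of_isoModSerre (χ : AdditiveFunction A) {P : ObjectProperty A} [P.IsSerreClass]
    (hP : P ≤ χ.kernelClass) {X Y : A} {f : X ⟶ Y} (hf : P.isoModSerre f) : χ X = χ Y := by
  have h₁ := χ.map_mono (kernel.ι f)
  have h₂ := χ.map_epi (cokernel.π f)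
  have h₃ : χ (cokernel (kernel.ι f)) = χ (kernel (cokernel.π f)) :=
    χ.map_iso (Abelian.coimageIsoImage f)
  have h₄ : χ (kernel f) = 0 := hP _ hf.1
  have h₅ : χ (cokernel f) = 0 := hP _ hf.2
  omega

/-- An isomorphism in the quotient is a right fraction; its denominator is inverted by construction,
hence its numerator becomes invertible too. Both legs thus have kernel and cokernel in `P`, and such
morphisms preserve `χ`. -/
lemma map_eq_of_iso_functor_obj (χ : AdditiveFunction A) {P : ObjectProperty A} [P.IsSerreClass]
    (hP : P ≤ χ.kernelClass) {X Y : A}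
    (e : (SerreQuotient.functor P).obj X ≅ (SerreQuotient.functor P).obj Y) : χ X = χ Y := by
  obtain ⟨φ, hφ⟩ := Localization.exists_rightFraction P.isoModSerre.Q P.isoModSerre e.hom
  have hs : IsIso (P.isoModSerre.Q.map φ.s) := Localization.inverts _ P.isoModSerre _ φ.hs
  have hf : P.isoModSerre.Q.map φ.f = P.isoModSerre.Q.map φ.s ≫ e.hom := by
    rw [hφ, MorphismProperty.RightFraction.map_s_comp_map]
  have : IsIso (P.isoModSerre.Q.map φ.f) := by rw [hf]; infer_instance
  rw [ObjectProperty.SerreClassLocalization.isIso_map_iff _ P] at this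
  rw [← χ.map_eq_of_isoModSerre hP φ.hs, χ.map_eq_of_isoModSerre hP this]

/-- The additive function induced on the quotient by a Serre class on which the given one
vanishes. -/
noncomputable def descend (χ : AdditiveFunction A) (P : ObjectProperty A) [P.IsSerreClass]
    (hP : P ≤ χ.kernelClass) : AdditiveFunction (SerreQuotient P) where
  toFun Y := χ (SerreQuotient.underlying P Y)
  map_shortExact E hE := by
    have := hE.mono_f
    -- Up to isomorphism `E.f` comes from a monomorphism `f` of `A`, so `E` is the image of the
    -- short exact sequence given by `f` and its cokernel.
    obtain ⟨X', Y', f, _, ⟨e⟩⟩ :=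
      (ObjectProperty.SerreClassLocalization.mono_iff P.isoModSerre.Q P E.f).1 this
    let F := SerreQuotient.functor P
    let e₁ : F.obj X' ≅ E.X₁ := Arrow.leftFunc.mapIso e
    let e₂ : F.obj Y' ≅ E.X₂ := Arrow.rightFunc.mapIso e
    have comm : F.map f ≫ e₂.hom = e₁.hom ≫ E.f := (Arrow.w e.hom).symm
    let e₃ : F.obj (cokernel f) ≅ E.X₃ :=
      PreservesCokernel.iso F f ≪≫ cokernel.mapIso (F.map f) E.f e₁ e₂ comm ≪≫
        (colimit.isColimit _).coconePointUniqueUpToIso hE.gIsCokernel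
    have h₁ : χ X' = χ (SerreQuotient.underlying P E.X₁) := χ.map_eq_of_iso_functor_obj hP e₁
    have h₂ : χ Y' = χ (SerreQuotient.underlying P E.X₂) := χ.map_eq_of_iso_functor_obj hP e₂
    have h₃ : χ (cokernel f) = χ (SerreQuotient.underlying P E.X₃) :=
      χ.map_eq_of_iso_functor_obj hP e₃
    rw [← h₁, ← h₂, ← h₃]
    exact χ.map_mono f

lemma descend_isFaithful (χ : AdditiveFunction A) (hP : P = χ.kernelClass) :
    (χ.descend P hP.le).IsFaithful := fun Y hY => by
  rw [SerreQuotient.isZero_iff]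
  exact hP.ge _ hY

/-- The composite of an additive function with an exact functor. -/
def comp {D : Type*} [Category* D] [Abelian D] (χ : AdditiveFunction D) (F : A ⥤ D)
    [PreservesFiniteLimits F] [PreservesFiniteColimits F] : AdditiveFunction A where
  toFun X := χ (F.obj X)
  map_shortExact E hE := by
    have := F.preservesZeroMorphisms_of_preserves_terminal_object
    exact χ.map_shortExact _ (hE.map_of_exact F)

end AdditiveFunction

end

/-! ### Classification of irreducible additive functions in the presence of a faithful one -/

section

variable {D : Type u} [Category.{v} D] [Abelian D]

lemma exists_isRepresentativeSetOfSimples (D : Type u) [Category.{v} D] [Abelian D] :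
    ∃ R : Set D, IsRepresentativeSetOfSimples R := by
  -- Representatives are the simple objects that `Quotient.out` picks from their own isomorphism
  -- class.
  refine ⟨{S | Simple S ∧ Quotient.out (Quotient.mk (isIsomorphicSetoid D) S) = S},
    fun S hS => hS.1, fun T hT => ?_⟩
  obtain ⟨e⟩ : IsIsomorphic (Quotient.out (Quotient.mk (isIsomorphicSetoid D) T)) T :=
    Quotient.mk_out (s := isIsomorphicSetoid D) T
  refine ⟨_, ⟨⟨Simple.of_iso e, ?_⟩, ⟨e.symm⟩⟩, ?_⟩
  · rw [Quotient.out_eq]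
  · rintro S ⟨⟨_, hS⟩, h⟩
    rw [← hS]
    exact congrArg Quotient.out (Quotient.sound (s := isIsomorphicSetoid D)
      (show IsIsomorphic S T from h.map Iso.symm))

namespace AdditiveFunction

lemma exists_ne_zero_of_ne_zero {χ : AdditiveFunction D} (h : χ ≠ 0) : ∃ X, χ X ≠ 0 := by
  by_contra! h'
  exact h (AdditiveFunction.ext (funext h'))

namespace IsFaithful

variable {χ : AdditiveFunction D} (hχ : χ.IsFaithful)

include hχ in
lemma ext_simple {α β : AdditiveFunction D} (h : ∀ T : D, Simple T → α T = β T) : α = β := by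
  refine AdditiveFunction.ext (funext fun X => ?_)
  obtain ⟨l, hl⟩ := hχ.exists_hasCompositionFactors X
  rw [← hl.sum_map α, ← hl.sum_map β,
    List.map_congr_left fun T hT => h T (hl.simple_of_mem T hT)]

open scoped Classical in
/-- The multiplicity of `S` as a composition factor. -/
noncomputable def multiplicity (S : D) : AdditiveFunction D :=
  hχ.ofWeights (fun T => if Nonempty (T ≅ S) then 1 else 0) fun T T' e => by
    have : Nonempty (T ≅ S) ↔ Nonempty (T' ≅ S) :=
      ⟨fun ⟨f⟩ => ⟨e.symm ≪≫ f⟩, fun ⟨f⟩ => ⟨e ≪≫ f⟩⟩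
    simp only [this]

open scoped Classical in
lemma multiplicity_of_simple (S : D) {T : D} (hT : Simple T) :
    hχ.multiplicity S T = if Nonempty (T ≅ S) then 1 else 0 := by
  rw [multiplicity, hχ.ofWeights_apply _ (.of_simple hT)]
  simp

lemma multiplicity_self {S : D} (hS : Simple S) : hχ.multiplicity S S = 1 := by
  rw [multiplicity_of_simple hχ S hS, if_pos ⟨Iso.refl S⟩]

/-- By Jordan-Hölder the multiplicity can be computed from any series, so one series avoiding `S`
means that all do. -/
lemma noFactorClass_iff (S X : D) : noFactorClass S X ↔ hχ.multiplicity S X = 0 := by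
  have key : ∀ l, HasCompositionFactors X l →
      (hχ.multiplicity S X = 0 ↔ ∀ T ∈ l, ¬ Nonempty (T ≅ S)) := fun l hl => by
    rw [multiplicity, hχ.ofWeights_apply _ hl, List.sum_eq_zero_iff]
    simp
  constructor
  · rintro ⟨l, hl, h⟩
    exact (key l hl).2 h
  · intro h
    obtain ⟨l, hl⟩ := hχ.exists_hasCompositionFactors X
    exact ⟨l, hl, (key l hl).1 h⟩

lemma eq_mul_multiplicity {α : AdditiveFunction D} {S : D}
    (hα : ∀ T : D, Simple T → ¬ Nonempty (T ≅ S) → α T = 0) (X : D) :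
    α X = α S * hχ.multiplicity S X := by
  obtain ⟨l, hl⟩ := hχ.exists_hasCompositionFactors X
  rw [← hl.sum_map α, ← hl.sum_map (hχ.multiplicity S), ← List.sum_map_mul_left]
  refine congrArg List.sum (List.map_congr_left fun T hT => ?_)
  rw [multiplicity_of_simple hχ S (hl.simple_of_mem T hT)]
  split_ifs with h
  · rw [mul_one, α.map_iso h.some]
  · rw [mul_zero, hα T (hl.simple_of_mem T hT) h]

/-- Both summands vanish on the simple objects not isomorphic to `S`, so they are multiples of the
multiplicity with coefficients in ℕ adding up to 1; one coefficient is 0. -/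
lemma multiplicity_isIrreducible {S : D} (hS : Simple S) : (hχ.multiplicity S).IsIrreducible := by
  refine ⟨fun h => ?_, fun α β h => ?_⟩
  · have := hχ.multiplicity_self hS
    rw [h] at this
    exact zero_ne_one this
  · have hab : ∀ X, hχ.multiplicity S X = α X + β X := fun X => by rw [h]; rfl
    have hα : ∀ X, α X = α S * hχ.multiplicity S X :=
      hχ.eq_mul_multiplicity fun T hT hTS => by
        have := hab T
        rw [multiplicity_of_simple hχ S hT, if_neg hTS] at this
        omega
    have hβ : ∀ X, β X = β S * hχ.multiplicity S X :=
      hχ.eq_mul_multiplicity fun T hT hTS => by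
        have := hab T
        rw [multiplicity_of_simple hχ S hT, if_neg hTS] at this
        omega
    have h₁ := hab S
    rw [hχ.multiplicity_self hS] at h₁
    rcases (by omega : α S = 0 ∨ β S = 0) with h0 | h0
    · exact Or.inl (AdditiveFunction.ext (funext fun X => by
        exact (hα X).trans (by rw [h0, zero_mul]; rfl)))
    · exact Or.inr (AdditiveFunction.ext (funext fun X => by
        exact (hβ X).trans (by rw [h0, zero_mul]; rfl)))

variable {R : Set D} (hR : IsRepresentativeSetOfSimples R)
include hR

lemma multiplicity_of_mem [DecidableEq R] (S S' : R) :
    hχ.multiplicity (S : D) S' = if S = S' then 1 else 0 := by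
  have key : Nonempty ((S' : D) ≅ S) ↔ S = S' := by
    constructor
    · exact fun h => Subtype.ext
        ((hR.2 _ (hR.1 _ S'.2)).unique ⟨S.2, h⟩ ⟨S'.2, ⟨Iso.refl _⟩⟩)
    · rintro rfl
      exact ⟨Iso.refl _⟩
  rw [multiplicity_of_simple hχ _ (hR.1 _ S'.2)]
  by_cases h : S = S'
  · rw [if_pos h, if_pos (key.2 h)]
  · rw [if_neg h, if_neg (mt key.1 h)]

/-- Induction on a series: a top factor isomorphic to `S₀` raises the multiplicity of `S₀` by one
and changes no other. -/
lemma finite_and_eq_finsum (α : AdditiveFunction D) (X : D) :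
    {S : R | hχ.multiplicity (S : D) X ≠ 0}.Finite ∧
      α X = ∑ᶠ S : R, α S * hχ.multiplicity (S : D) X := by
  classical
  obtain ⟨l, hl⟩ := hχ.exists_hasCompositionFactors X
  induction hl with
  | nil hX => simp [AdditiveFunction.map_isZero _ hX]
  | @cons X' X T l i p w hE hT h ih =>
    obtain ⟨S₀, ⟨hS₀, ⟨e⟩⟩, -⟩ := hR.2 T hT
    lift S₀ to R using hS₀
    have hadd : ∀ S : R, hχ.multiplicity (S : D) X =
        hχ.multiplicity (S : D) X' + if S = S₀ then 1 else 0 := fun S => by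
      rw [(hχ.multiplicity (S : D)).map_shortExact _ hE, ← hχ.multiplicity_of_mem hR,
        (hχ.multiplicity (S : D)).map_iso e]
    have hα : α X = α X' + α S₀ := by
      rw [α.map_shortExact _ hE, ← α.map_iso e]
    constructor
    · refine (ih.1.union (Set.finite_singleton S₀)).subset fun S hS => ?_
      by_contra hc
      simp only [Set.mem_union, Set.mem_ofPred_eq, Set.mem_singleton_iff, not_or, not_not] at hc
      exact hS (by rw [hadd, hc.1, if_neg hc.2])
    · simp only [hadd, mul_add]
      rw [finsum_add_distrib, ← ih.2, hα, finsum_eq_single _ S₀, if_pos rfl, mul_one]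
      · intro S hS
        rw [if_neg hS, mul_zero]
      · exact ih.1.subset fun S hS => right_ne_zero_of_mul hS
      · refine (Set.finite_singleton S₀).subset fun S hS => ?_
        by_contra hc
        exact hS (mul_eq_zero_of_right _ (if_neg hc))

/-- A non-zero `ψ` is non-zero at some `S` in `R`; the multiplicity of `S` then splits off from `ψ`,
and irreducibility kills the remainder. -/
lemma exists_eq_multiplicity {ψ : AdditiveFunction D} (hψ : ψ.IsIrreducible) :
    ∃ S : R, ψ = hχ.multiplicity (S : D) := by
  classical
  obtain ⟨X, hX⟩ := exists_ne_zero_of_ne_zero hψ.1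
  obtain ⟨S, hS⟩ : ∃ S : R, ψ S ≠ 0 := by
    by_contra! h
    exact hX (by simp [(hχ.finite_and_eq_finsum hR ψ X).2, h])
  have hS' := hR.1 _ S.2
  have hdecomp : ψ = hχ.multiplicity (S : D) +
      -- Nothing is truncated on simple objects: where the multiplicity is 1, `T ≅ S` and `ψ T = ψ S
      -- ≥ 1`.
      hχ.ofWeights (fun T => ψ T - hχ.multiplicity (S : D) T) (fun T T' e => by
        rw [ψ.map_iso e, (hχ.multiplicity (S : D)).map_iso e]) := by
    refine hχ.ext_simple fun T hT => ?_
    change ψ T = hχ.multiplicity (S : D) T + hχ.ofWeights _ _ T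
    rw [hχ.ofWeights_apply _ (.of_simple hT)]
    simp only [List.map_cons, List.map_nil, List.sum_cons, List.sum_nil, add_zero]
    rw [multiplicity_of_simple hχ _ hT]
    split_ifs with h
    · have := ψ.map_iso h.some
      omega
    · omega
  rcases hψ.2 _ _ hdecomp with h | h
  · exact ((hχ.multiplicity_isIrreducible hS').1 h).elim
  · refine ⟨S, AdditiveFunction.ext (funext fun X => ?_)⟩
    rw [h] at hdecomp
    exact congrArg (fun α : AdditiveFunction D => α X) hdecomp

end IsFaithful

/-- The number of members of a family that equal a given multiplicity function is determined
by the sum of the family. -/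
lemma IsFaithful.finite_fiber_and_card {χ : AdditiveFunction D} (hχ : χ.IsFaithful) {R : Set D}
    (hR : IsRepresentativeSetOfSimples R) {I : Type w} {ψ : I → AdditiveFunction D}
    {s : I → R} (hs : ∀ i, ψ i = hχ.multiplicity (s i : D)) {α : AdditiveFunction D}
    (hψ : IsLocallyFiniteSum ψ α) (S : R) :
    Finite {i // s i = S} ∧ Nat.card {i // s i = S} = α S := by
  classical
  have hval : ∀ i, ψ i (S : D) = if s i = S then 1 else 0 := fun i => by
    rw [hs, hχ.multiplicity_of_mem hR]
  obtain ⟨hfin, hsum⟩ := hψ S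
  have hset : {i | ψ i (S : D) ≠ 0} = {i | s i = S} := by
    ext i
    simp [hval]
  rw [hset] at hfin
  refine ⟨hfin, ?_⟩
  have hsub : Function.support (fun i => ψ i (S : D)) ⊆ hfin.toFinset := fun i hi => by
    simpa using hset.le hi
  rw [hsum, finsum_eq_sum_of_support_subset _ hsub,
    Finset.sum_congr rfl (g := fun _ => 1) fun i hi => by
      rw [hval, if_pos (by simpa using hi)],
    Finset.sum_const, smul_eq_mul, mul_one]
  exact Nat.card_eq_card_finite_toFinset hfin

/-- Decompositions into irreducible additive functions are unique. -/
lemma IsFaithful.exists_equiv {χ : AdditiveFunction D} (hχ : χ.IsFaithful)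
    {I : Type w} {J : Type w'} {ψ : I → AdditiveFunction D} {φ : J → AdditiveFunction D}
    {α : AdditiveFunction D}
    (hψ : ∀ i, (ψ i).IsIrreducible) (hψα : IsLocallyFiniteSum ψ α)
    (hφ : ∀ j, (φ j).IsIrreducible) (hφα : IsLocallyFiniteSum φ α) :
    ∃ e : I ≃ J, ∀ i, ψ i = φ (e i) := by
  obtain ⟨R, hR⟩ := exists_isRepresentativeSetOfSimples D
  choose s hs using fun i => hχ.exists_eq_multiplicity hR (hψ i)
  choose t ht using fun j => hχ.exists_eq_multiplicity hR (hφ j)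
  -- Both fibres over `S` are finite with `α S` elements; gluing the fibrewise bijections gives `e`.
  have e (S : R) : Nonempty ({i // s i = S} ≃ {j // t j = S}) := by
    obtain ⟨_, h₁⟩ := hχ.finite_fiber_and_card hR hs hψα S
    obtain ⟨_, h₂⟩ := hχ.finite_fiber_and_card hR ht hφα S
    exact Finite.card_eq.1 (h₁.trans h₂.symm)
  refine ⟨(Equiv.sigmaFiberEquiv s).symm.trans
    ((Equiv.sigmaCongrRight fun S => (e S).some).trans (Equiv.sigmaFiberEquiv t)), fun i => ?_⟩
  rw [hs, ht]
  congr 2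
  exact ((e (s i)).some ⟨i, rfl⟩).2.symm

end AdditiveFunction

end

/-! ### Return to `A`: decompositions, and multiplicities as lengths -/

namespace AdditiveFunction

variable {A : Type u} [Category.{v} A] [Abelian A] (χ : AdditiveFunction A)

section Descend

variable {χ} {P : ObjectProperty A} [P.IsSerreClass]

lemma descend_isIrreducible_iff (hP : P ≤ χ.kernelClass) :
    (χ.descend P hP).IsIrreducible ↔ χ.IsIrreducible := by
  constructor
  · rintro ⟨h0, h⟩
    refine ⟨?_, fun α β hab => ?_⟩
    · rintro rfl
      exact h0 rfl
    · subst hab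
      have hα : P ≤ α.kernelClass := fun X hX => (Nat.add_eq_zero_iff.1 (hP X hX)).1
      have hβ : P ≤ β.kernelClass := fun X hX => (Nat.add_eq_zero_iff.1 (hP X hX)).2
      -- The decomposition descends by `rfl`, since a descended function is evaluated on underlying
      -- objects.
      refine (h (α.descend P hα) (β.descend P hβ) rfl).imp (fun h => ?_) (fun h => ?_) <;>
      · ext X
        exact congrArg (fun α : AdditiveFunction _ => α ((SerreQuotient.functor P).obj X)) h
  · rintro ⟨h0, h⟩
    refine ⟨fun hc => h0 ?_, fun α β hab => ?_⟩
    · ext X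
      exact congrArg (fun α : AdditiveFunction _ => α ((SerreQuotient.functor P).obj X)) hc
    · have hcomp : χ = α.comp (SerreQuotient.functor P) + β.comp (SerreQuotient.functor P) := by
        ext X
        exact congrArg (fun α : AdditiveFunction _ => α ((SerreQuotient.functor P).obj X)) hab
      refine (h _ _ hcomp).imp (fun h => ?_) (fun h => ?_) <;>
      · ext X
        exact congrArg (fun α : AdditiveFunction _ => α (SerreQuotient.underlying P X)) h

lemma comp_isIrreducible {α : AdditiveFunction (SerreQuotient P)} (hα : α.IsIrreducible) :
    (α.comp (SerreQuotient.functor P)).IsIrreducible := by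
  have hP : P ≤ (α.comp (SerreQuotient.functor P)).kernelClass := fun X hX =>
    α.map_isZero ((SerreQuotient.isZero_functor_obj_iff P X).2 hX)
  rw [← descend_isIrreducible_iff hP]
  exact hα

/-- A finite sum of natural numbers vanishes only if each term does. This lets the members of a
decomposition descend to `A/S_χ`. -/
lemma IsLocallyFiniteSum.kernelClass_le {I : Type w} {ψ : I → AdditiveFunction A}
    (h : IsLocallyFiniteSum ψ χ) (i : I) : χ.kernelClass ≤ (ψ i).kernelClass := fun X hX => by
  obtain ⟨hfin, hsum⟩ := h X
  have h0 : ∑ᶠ i, ψ i X = 0 := hsum.symm.trans hX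
  rw [finsum_eq_sum_of_support_subset (s := hfin.toFinset) _ (by
    rw [Set.Finite.coe_toFinset]; rfl), Finset.sum_eq_zero_iff] at h0
  by_contra hi
  exact hi (h0 i (hfin.mem_toFinset.2 hi))

end Descend

lemma descend_kernelClass_isFaithful : (χ.descend χ.kernelClass le_rfl).IsFaithful :=
  χ.descend_isFaithful χ.kernelClass rfl

/-- An object of `A` becomes simple in the quotient by the kernel of `χ` if `χ` takes only
the extreme values on its subobjects. -/
lemma simple_functor_obj {X : A} (hX : χ X ≠ 0)
    (h : ∀ {W : A} (f : W ⟶ X) [Mono f], χ W = 0 ∨ χ W = χ X) :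
    Simple ((SerreQuotient.functor χ.kernelClass).obj X) := by
  refine χ.descend_kernelClass_isFaithful.simple hX fun {Y} g _ => ?_
  let Q := χ.kernelClass.isoModSerre.Q
  let Y' : A := SerreQuotient.underlying χ.kernelClass Y
  let g' : Q.obj Y' ⟶ Q.obj X := g
  have : Mono g' := ‹Mono g›
  -- A subobject of `X` in the quotient is represented by a fraction; the image of its numerator is
  -- a subobject in `A` with the same value of `χ`.
  obtain ⟨φ, hφ⟩ := Localization.exists_rightFraction Q χ.kernelClass.isoModSerre g'
  have hs : IsIso (Q.map φ.s) := Localization.inverts _ χ.kernelClass.isoModSerre _ φ.hs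
  have hf : Q.map φ.f = Q.map φ.s ≫ g' := by
    rw [hφ, MorphismProperty.RightFraction.map_s_comp_map]
  have hm : Mono (Q.map φ.f) := by rw [hf]; infer_instance
  rw [ObjectProperty.SerreClassLocalization.mono_map_iff Q χ.kernelClass] at hm
  have e₁ : χ φ.X' = χ Y' := χ.map_eq_of_isoModSerre le_rfl φ.hs
  have e₂ : χ φ.X' = χ (Abelian.image φ.f) :=
    χ.map_eq_of_isoModSerre le_rfl hm.isoModSerre_factorThruImage
  have := h (Abelian.image.ι φ.f)
  rwa [← e₂, e₁] at this

/-- The multiplicity in `X`, seen as an object of the quotient by the kernel of `χ`, of the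
composition factor `S`. -/
noncomputable def factorMultiplicity (S : SerreQuotient χ.kernelClass) : AdditiveFunction A :=
  (χ.descend_kernelClass_isFaithful.multiplicity S).comp (SerreQuotient.functor χ.kernelClass)

lemma avoidingClass_eq (S : SerreQuotient χ.kernelClass) :
    avoidingClass χ.kernelClass S = (χ.factorMultiplicity S).kernelClass := by
  ext X
  exact χ.descend_kernelClass_isFaithful.noFactorClass_iff S _

lemma factorMultiplicity_eq_one_of_simple (S : SerreQuotient χ.kernelClass) (X : A)
    (hX : Simple ((SerreQuotient.functor (avoidingClass χ.kernelClass S)).obj X)) :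
    χ.factorMultiplicity S X = 1 := by
  induction hn : χ X using Nat.strong_induction_on generalizing X with
  | _ n ih =>
    subst hn
    let G := SerreQuotient.functor (avoidingClass χ.kernelClass S)
    have hG : ∀ Y : A, IsZero (G.obj Y) ↔ χ.factorMultiplicity S Y = 0 := fun Y => by
      rw [SerreQuotient.isZero_functor_obj_iff, χ.avoidingClass_eq]
      rfl
    have h0 : χ.factorMultiplicity S X ≠ 0 := fun h => Simple.not_isZero _ ((hG X).2 h)
    -- If no subobject has an intermediate value of `χ`, then `X` is already simple in `A/S_χ`, so
    -- the multiplicity is 0 or 1, and `h0` excludes 0. Otherwise `X` is replaced by `W` or `X/W`,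
    -- whichever survives in `A/S_S`; by simplicity it is isomorphic to `X` there, and its value of
    -- `χ` is smaller.
    by_cases h : ∀ (W : A) (f : W ⟶ X), Mono f → χ W = 0 ∨ χ W = χ X
    · have hχX : χ X ≠ 0 := fun hc => h0 (AdditiveFunction.map_isZero
        (χ.descend_kernelClass_isFaithful.multiplicity S)
        ((SerreQuotient.isZero_functor_obj_iff χ.kernelClass X).2 hc))
      have hs := χ.simple_functor_obj hχX fun {W} f hf => h W f hf
      have := χ.descend_kernelClass_isFaithful.multiplicity_of_simple S hs
      change χ.factorMultiplicity S X = _ at this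
      rw [this] at h0 ⊢
      simpa using h0
    · push Not at h
      obtain ⟨W, f, _, hW, hWX⟩ := h
      have h₁ := χ.map_mono f
      have h₂ := (χ.factorMultiplicity S).map_mono f
      have hle : avoidingClass χ.kernelClass S ≤ (χ.factorMultiplicity S).kernelClass :=
        (χ.avoidingClass_eq S).le
      by_cases hz : G.map f = 0
      · have hGW : χ.factorMultiplicity S W = 0 := (hG W).1 (IsZero.of_mono_eq_zero _ hz)
        have hπ : G.map (cokernel.π f) ≠ 0 := fun hc => by
          have := (hG _).1 (IsZero.of_epi_eq_zero _ hc)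
          omega
        have : IsIso (G.map (cokernel.π f)) := isIso_of_epi_of_nonzero hπ
        rw [h₂, hGW, zero_add]
        exact ih _ (by omega) _ (Simple.of_iso (asIso (G.map (cokernel.π f))).symm) rfl
      · have : IsIso (G.map f) := isIso_of_mono_of_nonzero hz
        rw [← (χ.factorMultiplicity S).map_eq_of_iso_functor_obj hle (asIso (G.map f))]
        exact ih _ (by omega) _ (Simple.of_iso (asIso (G.map f))) rfl

lemma objectLength_eq_factorMultiplicity (S : SerreQuotient χ.kernelClass) (X : A) :
    objectLength ((SerreQuotient.functor (avoidingClass χ.kernelClass S)).obj X) =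
      χ.factorMultiplicity S X :=
  ((χ.factorMultiplicity S).descend_isFaithful _ (χ.avoidingClass_eq S)).objectLength_eq
    (fun T hT => χ.factorMultiplicity_eq_one_of_simple S (SerreQuotient.underlying _ T) hT) _

lemma factorMultiplicity_isIrreducible {S : SerreQuotient χ.kernelClass} (hS : Simple S) :
    (χ.factorMultiplicity S).IsIrreducible :=
  comp_isIrreducible (χ.descend_kernelClass_isFaithful.multiplicity_isIrreducible hS)

lemma finite_and_eq_finsum_factorMultiplicity {R : Set (SerreQuotient χ.kernelClass)}
    (hR : IsRepresentativeSetOfSimples R) (X : A) :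
    {S : R | χ.factorMultiplicity S X ≠ 0}.Finite ∧
      χ X = ∑ᶠ S : R, χ (SerreQuotient.underlying χ.kernelClass S) * χ.factorMultiplicity S X :=
  χ.descend_kernelClass_isFaithful.finite_and_eq_finsum hR (χ.descend χ.kernelClass le_rfl)
    ((SerreQuotient.functor χ.kernelClass).obj X)

/-- A sum with multiplicities as a sum over a family with repetitions. -/
lemma isLocallyFiniteSum_sigma {R : Type w} {ψ : R → AdditiveFunction A} {m : R → ℕ}
    (h : ∀ X, {S | ψ S X ≠ 0}.Finite ∧ χ X = ∑ᶠ S, m S * ψ S X) :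
    IsLocallyFiniteSum (fun i : Σ S : R, Fin (m S) => ψ i.1) χ := fun X => by
  obtain ⟨hfin, hsum⟩ := h X
  have hsub : {i : Σ S : R, Fin (m S) | ψ i.1 X ≠ 0} ⊆
      (hfin.toFinset.sigma fun S => (Finset.univ : Finset (Fin (m S)))) := fun i hi => by
    simpa using hi
  refine ⟨(Finset.finite_toSet _).subset hsub, ?_⟩
  rw [hsum, finsum_eq_sum_of_support_subset _ hsub, Finset.sum_sigma,
    finsum_eq_sum_of_support_subset (s := hfin.toFinset) _ fun S hS => by
      simpa using right_ne_zero_of_mul hS]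
  simp

end AdditiveFunction

theorem mainTheorem12 {A : Type u} [Category.{v} A] [Abelian A] (χ : AdditiveFunction A) :
    -- existence of a decomposition
    (∃ (I : Type u) (ψ : I → AdditiveFunction A),
      (∀ i, (ψ i).IsIrreducible) ∧ AdditiveFunction.IsLocallyFiniteSum ψ χ) ∧
    -- uniqueness of the decomposition, up to reindexing
    (∀ (I : Type w) (J : Type w') (ψ : I → AdditiveFunction A) (φ : J → AdditiveFunction A),
      (∀ i, (ψ i).IsIrreducible) → AdditiveFunction.IsLocallyFiniteSum ψ χ →
      (∀ j, (φ j).IsIrreducible) → AdditiveFunction.IsLocallyFiniteSum φ χ →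
      ∃ e : I ≃ J, ∀ i, ψ i = φ (e i)) ∧
    -- all objects of `A/S_χ` have finite length
    (∀ X : SerreQuotient χ.kernelClass, objectLength X ≠ ⊤) ∧
    -- the explicit decomposition `χ = ∑ χ(S) χ_S`, where `χ_S` is the length in `A/S_S`
    (∀ R : Set (SerreQuotient χ.kernelClass), IsRepresentativeSetOfSimples R →
      ∃ χ' : R → AdditiveFunction A,
        (∀ (S : R) (X : A), (χ' S X : ℕ∞) =
          objectLength ((SerreQuotient.functor (avoidingClass χ.kernelClass S)).obj X)) ∧
        (∀ S : R, (χ' S).IsIrreducible) ∧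
        ∀ X : A, {S : R | χ' S X ≠ 0}.Finite ∧
          χ X = ∑ᶠ S : R, χ (SerreQuotient.underlying χ.kernelClass S) * χ' S X) := by
  refine ⟨?_, ?_, χ.descend_kernelClass_isFaithful.objectLength_ne_top, ?_⟩
  · obtain ⟨R, hR⟩ := exists_isRepresentativeSetOfSimples (SerreQuotient χ.kernelClass)
    -- The coefficient of each `χ_S` is realised by repeating it that many times in the family.
    exact ⟨Σ S : R, Fin (χ (SerreQuotient.underlying χ.kernelClass S)),
      fun i => χ.factorMultiplicity i.1,
      fun i => χ.factorMultiplicity_isIrreducible (hR.1 _ i.1.2),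
      χ.isLocallyFiniteSum_sigma (ψ := fun S : R => χ.factorMultiplicity S)
        (χ.finite_and_eq_finsum_factorMultiplicity hR)⟩
  · intro I J ψ φ hψ hψχ hφ hφχ
    -- Uniqueness is applied in `A/S_χ` to the descended families; the resulting equalities are then
    -- evaluated at images of objects of `A`.
    obtain ⟨e, he⟩ := χ.descend_kernelClass_isFaithful.exists_equiv
      (ψ := fun i => (ψ i).descend _ (hψχ.kernelClass_le i))
      (φ := fun j => (φ j).descend _ (hφχ.kernelClass_le j))
      (α := χ.descend _ le_rfl)
      (fun i => (AdditiveFunction.descend_isIrreducible_iff _).2 (hψ i)) (fun X => hψχ _)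
      (fun j => (AdditiveFunction.descend_isIrreducible_iff _).2 (hφ j)) (fun X => hφχ _)
    refine ⟨e, fun i => ?_⟩
    ext X
    exact congrArg (fun α : AdditiveFunction _ =>
      α ((SerreQuotient.functor χ.kernelClass).obj X)) (he i)
  · intro R hR
    exact ⟨fun S => χ.factorMultiplicity S,
      fun S X => (χ.objectLength_eq_factorMultiplicity (S : SerreQuotient χ.kernelClass) X).symm,
      fun S => χ.factorMultiplicity_isIrreducible (hR.1 _ S.2),
      χ.finite_and_eq_finsum_factorMultiplicity hR⟩
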